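/- Let $\Delta_m=\{(t_0,\dots,t_m)\in\mathbb R^{m+1}: t_i\ge 0,\ \sum_i t_i=1\}$ denote the standard $m$-simplex with vertices $e_0,\dots,e_m$, and let $\emptyset\ne S\subseteq\bigcup_{m\ge1}\Delta_m$ (disjoint union). A function $h:\Delta_n\to\mathbb R$ is $S$-almost convex if $h(\sum_i t_ix_i)\le 1+\sum_i t_ih(x_i)$ for all $(t_0,\dots,t_m)\in S$ and $x_0,\dots,x_m\in\Delta_n$. An $S$-ranked probability measure is a triple $(X,\mu,(\pi_k)_{k\ge0})$ in which $\pi_0=\{X\}$, each $\pi_k$ is a finite partition of $X$ into nonempty sets, $\pi_{k+1}$ refines $\pi_k$, and $\mu$ is a probability measure on the $\sigma$-algebra generated by $\bigcup_k\pi_k$ such that for every $I\in\pi_k$ there is $(t_0,\dots,t_m)\in S$ for which the elements of $\pi_{k+1}$ contained in $I$ can be listed, without repetition, as $I_0,\dots,I_m$ with $\mu(I_i)=t_i\mu(I)$. The rank of $I\in\pi_k$ is $r(I)=k$, and $r(\emptyset)\mu(\emptyset)$ is read as $0$. For $x\in\Delta_n$ let $$E_S(x)=\inf\sum_{j=1}^\infty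 r(I_j)\mu(I_j),$$ the infimum being over all $S$-ranked probability measures and all sequences $(I_j)_{j\ge1}$ of pairwise disjoint members of $\{\emptyset\}\cup\bigcup_k\pi_k$ such that $\sum_j\mu(I_j)=1$ and such that $\{1,2,\dots\}$ can be partitioned into (possibly empty) sets $N_0,\dots,N_n$ with $x_k=\sum_{j\in N_k}\mu(I_j)$ for $0\le k\le n$. Let $\kappa_S(n)=\sup_{x\in\Delta_n}E_S(x)$. **Theorem.** Let $B\ge2$ be an integer, let $S=\{(1/B,\dots,1/B)\}\subset\Delta_{B-1}$ consist of the barycenter of $\Delta_{B-1}$, and let $n\ge0$ be an integer. Put $H_B(x)=\sum_{k=0}^\infty \{B^kx\}/B^k$, where $\{y\}=y-\lfloor y\rfloor$. Then: 1. For every $x=(x_0,\dots,x_n)\in\Delta_n$, $E_S(x)=H_B(x_0)+H_B(x_1)+\cdots+H_B(x_n)$; in particular $E_S(x)$ is finite. 2. $E_S$ is the extremal $S$-almost convex function on $\Delta_n$: it is bounded, $S$-almost convex and zero at the vertices $e_k$, and $h(x)\le E_S(x)$ for all $x\in\Delta_n$ whenever $h:\Delta_n\to\mathbb R$ is bounded,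 $S$-almost convex and satisfies $h(e_k)\le0$ for $0\le k\le n$. 3. If $n\ge1$, then $$\kappa_S(n)=\lfloor\log_Bn\rfloor+1+\frac{n}{(B-1)B^{\lfloor\log_Bn\rfloor}}.$$ -/

import Mathlib

open scoped ENNReal
open MeasureTheory

noncomputable section

/-- The disjoint union of the standard simplices of dimension at least one, indexed by the
number `N ≥ 2` of barycentric coordinates: an element is a pair of such an `N` and a point
`(t_0, …, t_{N-1})` of the `(N - 1)`-dimensional standard simplex. -/
abbrev SimplexPoint : Type :=
  Σ N : {N : ℕ // 2 ≤ N}, stdSimplex ℝ (Fin N.1)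

/-- `h` is `S`-almost convex on the convex set `C`. -/
def AlmostConvexOn (S : Set SimplexPoint) {V : Type*} [AddCommGroup V] [Module ℝ V]
    (C : Set V) (h : V → ℝ) : Prop :=
  ∀ p ∈ S, ∀ x : Fin p.1.1 → V, (∀ i, x i ∈ C) →
    h (∑ i, p.2.1 i • x i) ≤ 1 + ∑ i, p.2.1 i * h (x i)

/-- `h` is bounded on `C`. -/
def BoundedFunOn {V : Type*} (C : Set V) (h : V → ℝ) : Prop :=
  ∃ M : ℝ, ∀ x ∈ C, |h x| ≤ M

/-- `E` is the extremal `S`-almost convex function on the `n`-dimensional standard simplex: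
a bounded `S`-almost convex function that vanishes at the vertices and is the pointwise largest
among the bounded `S`-almost convex functions that are at most zero at the vertices. -/
structure IsExtremalAlmostConvex (S : Set SimplexPoint) (n : ℕ)
    (E : (Fin (n + 1) → ℝ) → ℝ) : Prop where
  bounded : BoundedFunOn (stdSimplex ℝ (Fin (n + 1))) E
  almostConvex : AlmostConvexOn S (stdSimplex ℝ (Fin (n + 1))) E
  vertex : ∀ k, E (Pi.single k 1) = 0
  largest : ∀ h : (Fin (n + 1) → ℝ) → ℝ,
    BoundedFunOn (stdSimplex ℝ (Fin (n + 1))) h →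
    AlmostConvexOn S (stdSimplex ℝ (Fin (n + 1))) h →
    (∀ k, h (Pi.single k 1) ≤ 0) →
    ∀ x ∈ stdSimplex ℝ (Fin (n + 1)), h x ≤ E x

/-- An `S`-ranked probability measure on `X`: a sequence of finite partitions of `X` into nonempty
sets, each refining the one before it and the first being `{X}`, with a probability
measure on the σ-algebra that they generate, such that each `I ∈ part k` is cut by `part (k + 1)`
into distinct pieces `J_0, …, J_m` of measures `t_0 μ(I), …, t_m μ(I)` for some
`(t_0, …, t_m) ∈ S`. -/
structure RankedMeasure (S : Set SimplexPoint) (X : Type) where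
  part : ℕ → Set (Set X)
  finite_part : ∀ k, (part k).Finite
  isPartition_part : ∀ k, Setoid.IsPartition (part k)
  part_zero : part 0 = {Set.univ}
  refines : ∀ k, ∀ J ∈ part (k + 1), ∃ I ∈ part k, J ⊆ I
  μ : @Measure X (MeasurableSpace.generateFrom (⋃ k, part k))
  measure_univ : μ Set.univ = 1
  split : ∀ k, ∀ I ∈ part k, ∃ p ∈ S, ∃ J : Fin p.1.1 → Set X,
    Function.Injective J ∧ Set.range J = {K | K ∈ part (k + 1) ∧ K ⊆ I} ∧
      ∀ i, μ (J i) = ENNReal.ofReal (p.2.1 i) * μ I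

/-- The rank of a set `I` belonging to one of the partitions: the `k` with `I ∈ part k`. It is
unique, since each piece is cut into at least two nonempty pieces at the next stage. (The value at
other sets, such as the empty set, is irrelevant.) -/
def RankedMeasure.rank {S : Set SimplexPoint} {X : Type} (R : RankedMeasure S X)
    (I : Set X) : ℕ :=
  sInf {k | I ∈ R.part k}

/-- `x` divides the sequence `α`: the index set can be partitioned into sets
`N_0, …, N_n` (namely `N_k = {j | c j = k}`) with `x_k = ∑_{j ∈ N_k} α_j`. -/
def Divides {n : ℕ} (x : Fin (n + 1) → ℝ) (α : ℕ → ℝ≥0∞) : Prop :=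
  ∃ c : ℕ → Fin (n + 1), ∀ k, ∑' j : {j // c j = k}, α j = ENNReal.ofReal (x k)

/-- The function `E_S` on the `n`-dimensional standard simplex: the infimum of
`∑_j r(I_j) μ(I_j)` over all `S`-ranked probability measures and all disjoint sequences `(I_j)` of
sets that are empty or belong to one of the partitions, with `∑_j μ(I_j) = 1` and such that
`x` divides the sequence `(μ(I_j))`. -/
def extremalE (S : Set SimplexPoint) (n : ℕ) (x : Fin (n + 1) → ℝ) : ℝ≥0∞ :=
  sInf {s | ∃ (X : Type) (R : RankedMeasure S X) (I : ℕ → Set X),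
    (∀ j, I j = ∅ ∨ ∃ k, I j ∈ R.part k) ∧
    Pairwise (fun i j => Disjoint (I i) (I j)) ∧
    ∑' j, R.μ (I j) = 1 ∧
    Divides x (fun j => R.μ (I j)) ∧
    s = ∑' j, (R.rank (I j) : ℝ≥0∞) * R.μ (I j)}

/-- `κ_S(n)`, the supremum of `E_S` over the `n`-dimensional standard simplex. -/
def kappa (S : Set SimplexPoint) (n : ℕ) : ℝ≥0∞ :=
  ⨆ x ∈ stdSimplex ℝ (Fin (n + 1)), extremalE S n x

/-- The barycenter `(1/B, …, 1/B)` of the standard simplex with `B` vertices. -/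
def barycenterPoint (B : ℕ) (hB : 2 ≤ B) : SimplexPoint :=
  ⟨⟨B, hB⟩, ⟨fun _ => 1 / (B : ℝ), fun _ => by positivity, by
    have : (B : ℝ) ≠ 0 := by positivity
    simp [this]⟩⟩

/-- `H_B(x) = ∑_{k ≥ 0} {B^k x} / B^k`, where `{y}` is the fractional part of `y`. -/
def fractSeries (B : ℕ) (x : ℝ) : ℝ :=
  ∑' k : ℕ, Int.fract ((B : ℝ) ^ k * x) / (B : ℝ) ^ k

end

/-! A set of rank `r` has mass `B ^ (-r)`, so computing `E_S` means writing every coordinate as a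
sum of masses `B ^ (-r)` with the least total of `r * B ^ (-r)`. Count ranks in layers: `r` is the
number of `l < r`. Masses of rank at most `l` contribute an integer to `B ^ l * x k`, so those of
rank above `l` contribute at least the fractional part (`ofReal_fract_div_pow_le`). Summing over `l`
gives the lower bound. Base `B` digits attain it (`extremalE_le_ofReal_sum_fractSeries`): listed by
decreasing size, the masses fill `[0, 1)` with consecutive `B`-adic intervals (`extremalE_le_tsum`).

The sum of the `H_B(x k)` is almost convex because `H_B` is subadditive and `H_B(y) = {y} + H_B(B y)
/ B`. It is the largest such function because iterating almost convexity bounds any competitor by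
partial sums of the same series plus a vanishing remainder (`exists_sum_eq_of_almostConvexOn`).

For `κ`, the sum over `k` of `{B ^ l * x k}` is an integer below `n + 1` and is at most `B ^ l`. A
single point attains `min n (B ^ l)` for all `l` at once (`exists_sum_fract_eq_min`). -/

/-! ### The series `H_B`. -/

theorem summable_fract_div_pow {B : ℕ} (hB : 2 ≤ B) (x : ℝ) :
    Summable fun k : ℕ => Int.fract ((B : ℝ) ^ k * x) / (B : ℝ) ^ k := by
  have hB' : (1 : ℝ) < B := by exact_mod_cast hB
  refine Summable.of_nonneg_of_le (fun k => div_nonneg (Int.fract_nonneg _) (by positivity))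
    (fun k => ?_) (summable_geometric_of_lt_one (r := (B : ℝ)⁻¹) (by positivity)
      (inv_lt_one_of_one_lt₀ hB'))
  rw [inv_pow, div_eq_mul_inv]
  exact mul_le_of_le_one_left (by positivity) (Int.fract_lt_one _).le

theorem fractSeries_nonneg (B : ℕ) (x : ℝ) : 0 ≤ fractSeries B x :=
  tsum_nonneg fun _ => div_nonneg (Int.fract_nonneg _) (by positivity)

theorem fractSeries_le {B : ℕ} (hB : 2 ≤ B) (x : ℝ) :
    fractSeries B x ≤ (1 - (B : ℝ)⁻¹)⁻¹ := by
  have hB' : (1 : ℝ) < B := by exact_mod_cast hB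
  rw [← tsum_geometric_of_lt_one (r := (B : ℝ)⁻¹) (by positivity) (inv_lt_one_of_one_lt₀ hB')]
  refine (summable_fract_div_pow hB x).tsum_le_tsum (fun k => ?_)
    (summable_geometric_of_lt_one (by positivity) (inv_lt_one_of_one_lt₀ hB'))
  rw [inv_pow, div_eq_mul_inv]
  exact mul_le_of_le_one_left (by positivity) (Int.fract_lt_one _).le

theorem fractSeries_eq_fract_add {B : ℕ} (hB : 2 ≤ B) (x : ℝ) :
    fractSeries B x = Int.fract x + fractSeries B (B * x) / B := by
  rw [fractSeries, (summable_fract_div_pow hB x).tsum_eq_zero_add, fractSeries, ← tsum_div_const]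
  congr 1
  · simp
  · refine tsum_congr fun k => ?_
    rw [pow_succ, mul_assoc, div_div]

theorem fractSeries_add_le {B : ℕ} (hB : 2 ≤ B) (x y : ℝ) :
    fractSeries B (x + y) ≤ fractSeries B x + fractSeries B y := by
  have hx := summable_fract_div_pow hB x
  have hy := summable_fract_div_pow hB y
  rw [fractSeries, fractSeries, fractSeries, ← hx.tsum_add hy]
  refine (summable_fract_div_pow hB _).tsum_le_tsum (fun k => ?_) (hx.add hy)
  rw [mul_add, ← add_div]
  gcongr
  exact Int.fract_add_le _ _

theorem fractSeries_intCast (B : ℕ) (m : ℤ) : fractSeries B m = 0 := by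
  have (k : ℕ) : Int.fract ((B : ℝ) ^ k * m) = 0 := by
    have : ((B : ℝ) ^ k * m) = ((B ^ k * m : ℤ) : ℝ) := by push_cast; rfl
    rw [this, Int.fract_intCast]
  simp [fractSeries, this]

theorem fractSeries_sum_le {B : ℕ} (hB : 2 ≤ B) {ι : Type*} (s : Finset ι) (f : ι → ℝ) :
    fractSeries B (∑ i ∈ s, f i) ≤ ∑ i ∈ s, fractSeries B (f i) :=
  Finset.le_sum_of_subadditive _ (by simpa using (fractSeries_intCast B 0).le)
    (fractSeries_add_le hB) s f

theorem fract_le_self {x : ℝ} (hx : 0 ≤ x) : Int.fract x ≤ x := by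
  have : (0 : ℝ) ≤ ⌊x⌋ := by exact_mod_cast Int.floor_nonneg.2 hx
  linarith [Int.floor_add_fract x]

theorem fract_pow_mul_fract (B k : ℕ) (x : ℝ) :
    Int.fract ((B : ℝ) ^ k * Int.fract x) = Int.fract ((B : ℝ) ^ k * x) := by
  have : (B : ℝ) ^ k * Int.fract x = (B : ℝ) ^ k * x - ((B ^ k * ⌊x⌋ : ℤ) : ℝ) := by
    rw [← Int.self_sub_floor]; push_cast; ring
  rw [this, Int.fract_sub_intCast]

/-! ### Extremality of the sum of the `H_B(x k)` among almost convex functions. -/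

theorem boundedFunOn_sum_fractSeries {B : ℕ} (hB : 2 ≤ B) {ι : Type*} [Fintype ι]
    (C : Set (ι → ℝ)) : BoundedFunOn C fun x => ∑ k, fractSeries B (x k) := by
  refine ⟨∑ _k : ι, (1 - (B : ℝ)⁻¹)⁻¹, fun x _ => ?_⟩
  rw [abs_of_nonneg (Finset.sum_nonneg fun _ _ => fractSeries_nonneg _ _)]
  exact Finset.sum_le_sum fun _ _ => fractSeries_le hB _

/-- The constant 1 comes from bounding the leading fractional parts by the coordinates of the
average, which sum to 1. The rest of each series is handled by subadditivity, since `B` times the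
average is the plain sum. -/
theorem sum_fractSeries_smul_sum_le {B : ℕ} (hB : 2 ≤ B) {ι : Type*} [Fintype ι]
    (x : Fin B → ι → ℝ) (hx : ∀ i, x i ∈ stdSimplex ℝ ι) :
    ∑ k, fractSeries B ((∑ i, (1 / (B : ℝ)) • x i) k) ≤
      1 + ∑ i, 1 / (B : ℝ) * ∑ k, fractSeries B (x i k) := by
  have hB0 : (B : ℝ) ≠ 0 := by positivity
  have hmem : ∑ i, (1 / (B : ℝ)) • x i ∈ stdSimplex ℝ ι :=
    (convex_stdSimplex ℝ ι).sum_mem (fun _ _ => by positivity) (by simp [hB0]) fun i _ => hx i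
  have key (k : ι) : fractSeries B ((∑ i, (1 / (B : ℝ)) • x i) k) ≤
      (∑ i, (1 / (B : ℝ)) • x i) k + ∑ i, 1 / (B : ℝ) * fractSeries B (x i k) := by
    rw [fractSeries_eq_fract_add hB]
    refine add_le_add (fract_le_self (hmem.1 k)) ?_
    have : (B : ℝ) * (∑ i, (1 / (B : ℝ)) • x i) k = ∑ i, x i k := by
      rw [Finset.sum_apply, Finset.mul_sum]
      exact Finset.sum_congr rfl fun i _ => by simp [hB0]
    rw [this, ← Finset.mul_sum, div_eq_inv_mul, one_div]
    gcongr
    exact fractSeries_sum_le hB _ _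
  refine (Finset.sum_le_sum fun k _ => key k).trans ?_
  rw [Finset.sum_add_distrib, hmem.2, Finset.sum_comm]
  simp_rw [Finset.mul_sum]
  exact le_rfl

theorem almostConvexOn_barycenterPoint {B : ℕ} (hB : 2 ≤ B) {V : Type*} [AddCommGroup V]
    [Module ℝ V] {C : Set V} {h : V → ℝ} :
    AlmostConvexOn {barycenterPoint B hB} C h ↔ ∀ x : Fin B → V, (∀ i, x i ∈ C) →
      h (∑ i, (1 / (B : ℝ)) • x i) ≤ 1 + ∑ i, 1 / (B : ℝ) * h (x i) := by
  constructor
  · intro H x hx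
    exact H _ rfl x hx
  · rintro H p rfl x hx
    exact H x hx

/-- Splitting off the integer parts of the coordinates as copies of the vertices. -/
theorem exists_sum_eq_of_fract {ι : Type} [Fintype ι] [DecidableEq ι] {h : (ι → ℝ) → ℝ}
    (hv : ∀ k, h (Pi.single k 1) ≤ 0) {w : ι → ℝ} (hw : ∀ k, 0 ≤ w k) {F : ℕ}
    (hF : ∑ k, w k = F) {c : ℝ}
    (H : ∀ F' : ℕ, ∑ k, Int.fract (w k) = F' → ∃ (σ : Type) (_ : Fintype σ) (x : σ → ι → ℝ),
      Fintype.card σ = F' ∧ (∀ i, x i ∈ stdSimplex ℝ ι) ∧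
        ∑ i, x i = (fun k => Int.fract (w k)) ∧ ∑ i, h (x i) ≤ c) :
    ∃ (σ : Type) (_ : Fintype σ) (x : σ → ι → ℝ),
      Fintype.card σ = F ∧ (∀ i, x i ∈ stdSimplex ℝ ι) ∧ ∑ i, x i = w ∧ ∑ i, h (x i) ≤ c := by
  have hfl (k : ι) : w k = (⌊w k⌋₊ : ℝ) + Int.fract (w k) := by
    rw [natCast_floor_eq_intCast_floor (hw k), Int.floor_add_fract]
  have hsum : (F : ℝ) = (∑ k, ⌊w k⌋₊ : ℕ) + ∑ k, Int.fract (w k) := by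
    rw [← hF, Nat.cast_sum, ← Finset.sum_add_distrib]
    exact Finset.sum_congr rfl fun k _ => hfl k
  have hle : ∑ k, ⌊w k⌋₊ ≤ F := by
    have : (0 : ℝ) ≤ ∑ k, Int.fract (w k) := Finset.sum_nonneg fun _ _ => Int.fract_nonneg _
    have : ((∑ k, ⌊w k⌋₊ : ℕ) : ℝ) ≤ F := by linarith
    exact_mod_cast this
  obtain ⟨σ, _, x, hc, hx, hs, hh⟩ := H (F - ∑ k, ⌊w k⌋₊) (by
    rw [Nat.cast_sub hle]; linarith)
  refine ⟨(Σ k, Fin ⌊w k⌋₊) ⊕ σ, inferInstance, Sum.elim (fun p => Pi.single p.1 1) x,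
    ?_, ?_, ?_, ?_⟩
  · simp [hc, hle]
  · rintro (p | i)
    · exact single_mem_stdSimplex ℝ p.1
    · exact hx i
  · rw [Fintype.sum_sum_type]
    simp only [Sum.elim_inl, Sum.elim_inr, hs]
    funext k
    rw [Fintype.sum_sigma]
    simp only [Pi.add_apply, Finset.sum_apply, Finset.sum_const, Finset.card_univ,
      Fintype.card_fin, nsmul_eq_mul, Pi.mul_apply, Pi.natCast_apply, Pi.single_apply]
    simp [← hfl k]
  · rw [Fintype.sum_sum_type]
    simp only [Sum.elim_inl, Sum.elim_inr]
    have : ∑ p : (Σ k, Fin ⌊w k⌋₊), h (Pi.single p.1 1) ≤ 0 :=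
      Finset.sum_nonpos fun p _ => hv p.1
    linarith

/-- Each round discards integer parts as vertices, at cost at most 0, and scales the fractional
parts by `B`. The points obtained recursively are averaged in blocks of `B`; each block costs 1, and
the number of blocks is the sum of the fractional parts, which is the `l = 0` term. After `m` rounds
the remaining points are bounded by `M` each. -/
theorem exists_sum_eq_of_almostConvexOn {B : ℕ} (hB : 2 ≤ B) {ι : Type} [Fintype ι]
    [DecidableEq ι] {h : (ι → ℝ) → ℝ} {M : ℝ} (hM : ∀ x ∈ stdSimplex ℝ ι, h x ≤ M)
    (hconv : AlmostConvexOn {barycenterPoint B hB} (stdSimplex ℝ ι) h)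
    (hv : ∀ k, h (Pi.single k 1) ≤ 0) (m : ℕ) :
    ∀ (w : ι → ℝ), (∀ k, 0 ≤ w k) → ∀ F : ℕ, ∑ k, w k = F →
    ∃ (σ : Type) (_ : Fintype σ) (x : σ → ι → ℝ),
      Fintype.card σ = F ∧ (∀ i, x i ∈ stdSimplex ℝ ι) ∧ ∑ i, x i = w ∧
      ∑ i, h (x i) ≤ ∑ l ∈ Finset.range m, ∑ k, Int.fract ((B : ℝ) ^ l * w k) / (B : ℝ) ^ l +
        M * ∑ k, Int.fract ((B : ℝ) ^ m * w k) / (B : ℝ) ^ m := by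
  have hB0 : (B : ℝ) ≠ 0 := by positivity
  rw [almostConvexOn_barycenterPoint] at hconv
  induction m with
  | zero =>
    intro w hw F hF
    refine exists_sum_eq_of_fract hv hw hF fun F' hF' => ?_
    -- The fractional part is split into `F'` equal points. For `F' = 0` the family is empty, so the
    -- division by zero is harmless.
    refine ⟨Fin F', inferInstance, fun _ k => Int.fract (w k) / F', by simp, fun i => ?_, ?_, ?_⟩
    · have : (F' : ℝ) ≠ 0 := by exact_mod_cast i.pos.ne'
      refine ⟨fun k => div_nonneg (Int.fract_nonneg _) (by positivity), ?_⟩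
      rw [← Finset.sum_div, hF', div_self this]
    · rcases F'.eq_zero_or_pos with rfl | hpos
      · rw [Nat.cast_zero, Finset.sum_eq_zero_iff_of_nonneg fun _ _ => Int.fract_nonneg _] at hF'
        funext k
        simp [hF' k (Finset.mem_univ k)]
      · have : (F' : ℝ) ≠ 0 := by exact_mod_cast hpos.ne'
        funext k
        simp [mul_div_cancel₀ _ this]
    · have : ∑ i : Fin F', h (fun k => Int.fract (w k) / F') ≤ ∑ _i : Fin F', M := by
        refine Finset.sum_le_sum fun i _ => hM _ ?_
        have : (F' : ℝ) ≠ 0 := by exact_mod_cast i.pos.ne'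
        refine ⟨fun k => div_nonneg (Int.fract_nonneg _) (by positivity), ?_⟩
        rw [← Finset.sum_div, hF', div_self this]
      simpa [hF', mul_comm] using this
  | succ m ih =>
    intro w hw F hF
    refine exists_sum_eq_of_fract hv hw hF fun F' hF' => ?_
    obtain ⟨σ, _, y, hc, hy, hs, hh⟩ := ih (fun k => (B : ℝ) * Int.fract (w k))
      (fun k => mul_nonneg (by positivity) (Int.fract_nonneg _)) (F' * B)
      (by rw [← Finset.mul_sum, hF']; push_cast; ring)
    -- Any grouping into blocks of size `B` works.
    let e : Fin F' × Fin B ≃ σ := Fintype.equivOfCardEq (by simp [hc])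
    refine ⟨Fin F', inferInstance, fun i => ∑ j, (1 / (B : ℝ)) • y (e (i, j)), by simp,
      fun i => ?_, ?_, ?_⟩
    · exact (convex_stdSimplex ℝ ι).sum_mem (fun _ _ => by positivity) (by simp [hB0])
        fun j _ => hy _
    · rw [← Fintype.sum_prod_type (f := fun p => (1 / (B : ℝ)) • y (e p)),
        e.sum_comp (fun s => (1 / (B : ℝ)) • y s), ← Finset.smul_sum, hs]
      funext k
      simp [hB0]
    · have h1 : ∑ i, h (∑ j, (1 / (B : ℝ)) • y (e (i, j))) ≤
          ∑ i : Fin F', (1 + ∑ j, 1 / (B : ℝ) * h (y (e (i, j)))) :=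
        Finset.sum_le_sum fun i _ => hconv _ fun j => hy _
      refine h1.trans ?_
      rw [Finset.sum_add_distrib,
        ← Fintype.sum_prod_type (f := fun p => (1 / (B : ℝ)) * h (y (e p))),
        e.sum_comp (fun s => (1 / (B : ℝ)) * h (y s))]
      have hterm (l : ℕ) (k : ι) : 1 / (B : ℝ) *
          (Int.fract ((B : ℝ) ^ l * ((B : ℝ) * Int.fract (w k))) / (B : ℝ) ^ l) =
          Int.fract ((B : ℝ) ^ (l + 1) * w k) / (B : ℝ) ^ (l + 1) := by
        rw [← mul_assoc, ← pow_succ, fract_pow_mul_fract, pow_succ]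
        field_simp
      have h2 := mul_le_mul_of_nonneg_left hh (show 0 ≤ 1 / (B : ℝ) by positivity)
      rw [mul_add, mul_left_comm, Finset.mul_sum, Finset.mul_sum] at h2
      simp_rw [Finset.mul_sum (a := 1 / (B : ℝ)), hterm] at h2
      rw [Finset.sum_range_succ']
      simp only [pow_zero, one_mul, div_one, hF']
      simp only [Finset.sum_const, Finset.card_univ, Fintype.card_fin, nsmul_eq_mul, mul_one]
      linarith

theorem le_sum_fractSeries {B : ℕ} (hB : 2 ≤ B) {ι : Type} [Fintype ι]
    [DecidableEq ι] {h : (ι → ℝ) → ℝ} (hbdd : BoundedFunOn (stdSimplex ℝ ι) h)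
    (hconv : AlmostConvexOn {barycenterPoint B hB} (stdSimplex ℝ ι) h)
    (hv : ∀ k, h (Pi.single k 1) ≤ 0) {x : ι → ℝ} (hx : x ∈ stdSimplex ℝ ι) :
    h x ≤ ∑ k, fractSeries B (x k) := by
  obtain ⟨M, hM⟩ := hbdd
  have bound (m : ℕ) : h x ≤
      ∑ l ∈ Finset.range m, ∑ k, Int.fract ((B : ℝ) ^ l * x k) / (B : ℝ) ^ l +
        M * ∑ k, Int.fract ((B : ℝ) ^ m * x k) / (B : ℝ) ^ m := by
    -- With total mass 1 the decomposition has one point, namely `x` itself.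
    obtain ⟨σ, _, y, hc, -, hs, hh⟩ := exists_sum_eq_of_almostConvexOn hB
      (fun x hx => (le_abs_self _).trans (hM x hx)) hconv hv m x hx.1 1 (by simpa using hx.2)
    obtain ⟨a, ha⟩ := Fintype.card_eq_one_iff.1 hc
    have huniv : (Finset.univ : Finset σ) = {a} := by ext b; simp [ha b]
    rw [huniv, Finset.sum_singleton] at hs hh
    rwa [hs] at hh
  refine ge_of_tendsto' (x := Filter.atTop) ?_ bound
  have hsum := hasSum_sum fun k (_ : k ∈ (Finset.univ : Finset ι)) =>
    (summable_fract_div_pow hB (x k)).hasSum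
  simpa [fractSeries] using hsum.tendsto_sum_nat.add (hsum.summable.tendsto_atTop_zero.const_mul M)

/-! ### Lower bound for `E_S`. -/

namespace RankedMeasure

variable {S : Set SimplexPoint} {X : Type}

theorem mem_part_rank (R : RankedMeasure S X) {I : Set X} (h : ∃ k, I ∈ R.part k) :
    I ∈ R.part (R.rank I) :=
  Nat.sInf_mem (s := {k | I ∈ R.part k}) h

theorem rank_le (R : RankedMeasure S X) {I : Set X} {k : ℕ} (h : I ∈ R.part k) :
    R.rank I ≤ k :=
  Nat.sInf_le (s := {k | I ∈ R.part k}) h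

theorem measure_eq_of_mem_part {B : ℕ} {hB : 2 ≤ B}
    (R : RankedMeasure {barycenterPoint B hB} X) (k : ℕ) :
    ∀ I ∈ R.part k, R.μ I = ENNReal.ofReal ((B : ℝ) ^ k)⁻¹ := by
  induction k with
  | zero =>
    intro I hI
    rw [R.part_zero] at hI
    rw [Set.mem_singleton_iff.1 hI, R.measure_univ]
    simp
  | succ k ih =>
    intro J hJ
    obtain ⟨I, hI, hJI⟩ := R.refines k J hJ
    obtain ⟨p, rfl, K, -, hK, hμ⟩ := R.split k I hI
    obtain ⟨i, rfl⟩ : J ∈ Set.range K := hK ▸ ⟨hJ, hJI⟩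
    rw [hμ, ih I hI]
    change ENNReal.ofReal (1 / (B : ℝ)) * _ = _
    rw [← ENNReal.ofReal_mul (by positivity), pow_succ, mul_inv, one_div, mul_comm]

end RankedMeasure

theorem ENNReal.tsum_ite_lt (r : ℕ) (a : ℝ≥0∞) :
    ∑' l : ℕ, (if l < r then a else 0) = r * a := by
  rw [tsum_eq_sum (s := Finset.range r) fun l hl => by simp_all]
  rw [Finset.sum_congr rfl fun l hl => if_pos (Finset.mem_range.1 hl)]
  simp

/-- The fractional part of `B ^ l * y` is at most the contribution to `B ^ l * y` of the terms
smaller than `B ^ (-l)`. -/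
theorem ofReal_fract_div_pow_le {B : ℕ} (hB : 2 ≤ B) {J : Type} {a : J → ℝ} {r : J → ℕ}
    (ha : ∀ j, a j = 0 ∨ a j = ((B : ℝ) ^ r j)⁻¹) {y : ℝ} (hy : HasSum a y) (l : ℕ) :
    ENNReal.ofReal (Int.fract ((B : ℝ) ^ l * y) / (B : ℝ) ^ l) ≤
      ∑' j, if l < r j then ENNReal.ofReal (a j) else 0 := by
  have hBl : (0 : ℝ) < (B : ℝ) ^ l := by positivity
  have ha0 (j : J) : 0 ≤ a j := by rcases ha j with h | h <;> rw [h]; positivity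
  let b : J → ℝ := fun j => if l < r j then a j else 0
  have hb0 (j : J) : 0 ≤ b j := by simp only [b]; split_ifs <;> simp [ha0]
  have hba (j : J) : b j ≤ a j := by simp only [b]; split_ifs <;> simp [ha0]
  have hb : Summable b := hy.summable.of_nonneg_of_le hb0 hba
  -- The terms of rank at most `l` become integers after multiplication by `B ^ l`. There may be
  -- infinitely many indices, so closedness of the integers in the reals is used to pass to the
  -- limit.
  have hint : (B : ℝ) ^ l * (y - ∑' j, b j) ∈ Set.range ((↑) : ℤ → ℝ) := by
    refine Int.isClosedEmbedding_coe_real.isClosed_range.mem_of_tendsto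
      ((hy.sub hb.hasSum).mul_left ((B : ℝ) ^ l)) (Filter.Eventually.of_forall fun s => ?_)
    refine (Int.castRingHom ℝ).range.sum_mem fun j _ => ?_
    simp only [b]
    split_ifs with hlt
    · simp
    · rcases ha j with h | h
      · simp [h]
      · refine ⟨(B : ℤ) ^ (l - r j), ?_⟩
        rw [h, sub_zero, ← div_eq_mul_inv, eq_div_iff (by positivity)]
        simp only [eq_intCast, Int.cast_pow, Int.cast_natCast]
        rw [← pow_add, Nat.sub_add_cancel (not_lt.1 hlt)]
  obtain ⟨N, hN⟩ := hint
  have hsum0 : 0 ≤ ∑' j, b j := tsum_nonneg hb0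
  have hfract : Int.fract ((B : ℝ) ^ l * y) ≤ (B : ℝ) ^ l * ∑' j, b j := by
    have : (B : ℝ) ^ l * y = N + (B : ℝ) ^ l * ∑' j, b j := by rw [hN]; ring
    rw [this, Int.fract_intCast_add]
    exact fract_le_self (by positivity)
  have : ∑' j, (if l < r j then ENNReal.ofReal (a j) else 0) = ENNReal.ofReal (∑' j, b j) := by
    rw [ENNReal.ofReal_tsum_of_nonneg hb0 hb]
    refine tsum_congr fun j => ?_
    simp only [b]
    split_ifs <;> simp
  rw [this]
  refine ENNReal.ofReal_le_ofReal ?_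
  rwa [div_le_iff₀' hBl]

/-- Double counting: sum the layer bounds over `l` and interchange the sums; index `j` is then
counted once for each `l < r j`. -/
theorem ofReal_fractSeries_le_tsum {B : ℕ} (hB : 2 ≤ B) {J : Type} {α : J → ℝ≥0∞} {r : J → ℕ}
    (hα : ∀ j, α j = 0 ∨ α j = ENNReal.ofReal ((B : ℝ) ^ r j)⁻¹) {y : ℝ} (hy0 : 0 ≤ y)
    (hy : ∑' j, α j = ENNReal.ofReal y) :
    ENNReal.ofReal (fractSeries B y) ≤ ∑' j, (r j : ℝ≥0∞) * α j := by
  have hfin : ∑' j, α j ≠ ∞ := hy ▸ ENNReal.ofReal_ne_top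
  have hsum : HasSum (fun j => (α j).toReal) y := by
    have := ENNReal.hasSum_toReal hfin
    rwa [← ENNReal.tsum_toReal_eq (fun j => ENNReal.ne_top_of_tsum_ne_top hfin j), hy,
      ENNReal.toReal_ofReal hy0] at this
  have ha (j : J) : (α j).toReal = 0 ∨ (α j).toReal = ((B : ℝ) ^ r j)⁻¹ := by
    rcases hα j with h | h
    · simp [h]
    · right; rw [h, ENNReal.toReal_ofReal (by positivity)]
  rw [fractSeries, ENNReal.ofReal_tsum_of_nonneg
    (fun k => div_nonneg (Int.fract_nonneg _) (by positivity)) (summable_fract_div_pow hB y)]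
  refine (ENNReal.tsum_le_tsum fun l => ofReal_fract_div_pow_le hB ha hsum l).trans ?_
  rw [ENNReal.tsum_comm]
  refine ENNReal.tsum_le_tsum fun j => ?_
  rw [ENNReal.tsum_ite_lt, ENNReal.ofReal_toReal (ENNReal.ne_top_of_tsum_ne_top hfin j)]

theorem ofReal_sum_fractSeries_le_extremalE {B : ℕ} (hB : 2 ≤ B) {n : ℕ} {x : Fin (n + 1) → ℝ}
    (hx : ∀ k, 0 ≤ x k) :
    ENNReal.ofReal (∑ k, fractSeries B (x k)) ≤ extremalE {barycenterPoint B hB} n x := by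
  refine le_sInf ?_
  rintro s ⟨X, R, I, hI, -, -, ⟨c, hc⟩, rfl⟩
  have hα (j : ℕ) : R.μ (I j) = 0 ∨
      R.μ (I j) = ENNReal.ofReal ((B : ℝ) ^ R.rank (I j))⁻¹ := by
    rcases hI j with h | h
    · left; rw [h, measure_empty]
    · exact Or.inr (R.measure_eq_of_mem_part _ _ (R.mem_part_rank h))
  rw [ENNReal.ofReal_sum_of_nonneg fun k _ => fractSeries_nonneg _ _,
    ← (Equiv.sigmaFiberEquiv c).tsum_eq, ENNReal.tsum_sigma', tsum_fintype]
  exact Finset.sum_le_sum fun k _ =>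
    ofReal_fractSeries_le_tsum hB (fun j : {j // c j = k} => hα j) (hx k) (hc k)

/-! ### Realization by `B`-adic intervals. -/

/-- The `B`-adic interval `[i / B ^ k, (i + 1) / B ^ k)`, as a subset of `[0, 1)`. -/
def adicCell (B k i : ℕ) : Set (Set.Ico (0 : ℝ) 1) :=
  {x | ⌊(B : ℝ) ^ k * x.1⌋₊ = i}

theorem adicCell_eq_preimage {B : ℕ} (hB : 2 ≤ B) (k i : ℕ) :
    adicCell B k i =
      Subtype.val ⁻¹' Set.Ico ((i : ℝ) / (B : ℝ) ^ k) (((i : ℝ) + 1) / (B : ℝ) ^ k) := by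
  have hBk : (0 : ℝ) < (B : ℝ) ^ k := by positivity
  ext x
  have := x.2.1
  simp only [adicCell, Set.mem_ofPred_eq, Set.mem_preimage, Set.mem_Ico]
  rw [Nat.floor_eq_iff (by positivity), div_le_iff₀' hBk, lt_div_iff₀' hBk]

theorem floor_pow_mul_lt {B : ℕ} (hB : 2 ≤ B) (k : ℕ) (x : Set.Ico (0 : ℝ) 1) :
    ⌊(B : ℝ) ^ k * x.1⌋₊ < B ^ k := by
  have hBk : (0 : ℝ) < (B : ℝ) ^ k := by positivity
  have := x.2.1
  rw [Nat.floor_lt (by positivity)]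
  push_cast
  nlinarith [x.2.2]

theorem floor_pow_succ_mul_div {B : ℕ} (hB : 2 ≤ B) (k : ℕ) (x : ℝ) :
    ⌊(B : ℝ) ^ (k + 1) * x⌋₊ / B = ⌊(B : ℝ) ^ k * x⌋₊ := by
  rw [← Nat.floor_div_natCast]
  congr 1
  have : (B : ℝ) ≠ 0 := by positivity
  rw [pow_succ]
  field_simp

theorem adicCell_nonempty {B : ℕ} (hB : 2 ≤ B) {k i : ℕ} (hi : i < B ^ k) :
    (adicCell B k i).Nonempty := by
  have hBk : (0 : ℝ) < (B : ℝ) ^ k := by positivity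
  have hi' : (i : ℝ) < (B : ℝ) ^ k := by exact_mod_cast hi
  refine ⟨⟨(i : ℝ) / (B : ℝ) ^ k, by positivity, (div_lt_one hBk).2 hi'⟩, ?_⟩
  simp [adicCell, mul_div_cancel₀ _ hBk.ne']

theorem adicCell_subset_iff {B : ℕ} (hB : 2 ≤ B) {k i j : ℕ} (hj : j < B ^ (k + 1)) :
    adicCell B (k + 1) j ⊆ adicCell B k i ↔ j / B = i := by
  constructor
  · intro h
    obtain ⟨x, hx⟩ := adicCell_nonempty hB hj
    have h1 : ⌊(B : ℝ) ^ (k + 1) * x.1⌋₊ = j := hx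
    have h2 : ⌊(B : ℝ) ^ k * x.1⌋₊ = i := h hx
    rw [← h1, floor_pow_succ_mul_div hB, h2]
  · rintro rfl x hx
    have h1 : ⌊(B : ℝ) ^ (k + 1) * x.1⌋₊ = j := hx
    change ⌊(B : ℝ) ^ k * x.1⌋₊ = j / B
    rw [← h1, floor_pow_succ_mul_div hB]

theorem measurableSet_adicCell {B : ℕ} (hB : 2 ≤ B) (k i : ℕ) :
    MeasurableSet (adicCell B k i) := by
  rw [adicCell_eq_preimage hB]
  exact measurable_subtype_coe measurableSet_Ico

/-- The partition of `[0, 1)` into the `B`-adic intervals of length `B ^ (-k)`. -/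
def adicPart (B k : ℕ) : Set (Set (Set.Ico (0 : ℝ) 1)) :=
  adicCell B k '' Set.Iio (B ^ k)

theorem generateFrom_adicPart_le {B : ℕ} (hB : 2 ≤ B) :
    MeasurableSpace.generateFrom (⋃ k, adicPart B k) ≤
      (inferInstance : MeasurableSpace (Set.Ico (0 : ℝ) 1)) := by
  refine MeasurableSpace.generateFrom_le fun t ht => ?_
  obtain ⟨k, i, -, rfl⟩ := Set.mem_iUnion.1 ht
  exact measurableSet_adicCell hB k i

/-- Lebesgue measure on the `σ`-algebra generated by the `B`-adic intervals. -/
noncomputable def adicMeasure {B : ℕ} (hB : 2 ≤ B) :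
    @Measure (Set.Ico (0 : ℝ) 1) (MeasurableSpace.generateFrom (⋃ k, adicPart B k)) :=
  (Measure.comap Subtype.val (volume : Measure ℝ)).trim (generateFrom_adicPart_le hB)

theorem adicMeasure_preimage_Ico {B : ℕ} (hB : 2 ≤ B) {a b : ℝ} (ha : 0 ≤ a) (hb : b ≤ 1)
    (h : MeasurableSet[MeasurableSpace.generateFrom (⋃ k, adicPart B k)]
      (Subtype.val ⁻¹' Set.Ico a b : Set (Set.Ico (0 : ℝ) 1))) :
    adicMeasure hB (Subtype.val ⁻¹' Set.Ico a b) = ENNReal.ofReal (b - a) := by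
  rw [adicMeasure, trim_measurableSet_eq _ h, comap_subtype_coe_apply measurableSet_Ico,
    Subtype.image_preimage_coe, Set.inter_eq_right.2 (Set.Ico_subset_Ico ha hb), Real.volume_Ico]

theorem measurableSet_generateFrom_adicPart {B k i : ℕ} (hi : i < B ^ k) :
    MeasurableSet[MeasurableSpace.generateFrom (⋃ k, adicPart B k)] (adicCell B k i) :=
  MeasurableSpace.measurableSet_generateFrom (Set.mem_iUnion.2 ⟨k, i, hi, rfl⟩)

theorem adicMeasure_adicCell {B : ℕ} (hB : 2 ≤ B) {k i : ℕ} (hi : i < B ^ k) :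
    adicMeasure hB (adicCell B k i) = ENNReal.ofReal ((B : ℝ) ^ k)⁻¹ := by
  have hBk : (0 : ℝ) < (B : ℝ) ^ k := by positivity
  have hi' : (i : ℝ) + 1 ≤ (B : ℝ) ^ k := by exact_mod_cast hi
  have hm := measurableSet_generateFrom_adicPart hi
  rw [adicCell_eq_preimage hB] at hm ⊢
  rw [adicMeasure_preimage_Ico hB (by positivity) ((div_le_one hBk).2 hi') hm]
  congr 1
  field_simp
  ring

/-- The ranked probability measure given by the `B`-adic intervals in `[0, 1)`. -/
noncomputable def adicRankedMeasure {B : ℕ} (hB : 2 ≤ B) :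
    RankedMeasure {barycenterPoint B hB} (Set.Ico (0 : ℝ) 1) where
  part := adicPart B
  finite_part k := (Set.finite_Iio _).image _
  isPartition_part k := by
    refine ⟨?_, fun x => ⟨adicCell B k ⌊(B : ℝ) ^ k * x.1⌋₊,
      ⟨⟨_, floor_pow_mul_lt hB k x, rfl⟩, rfl⟩, ?_⟩⟩
    · rintro ⟨i, hi, h⟩
      exact (adicCell_nonempty hB hi).ne_empty h
    · rintro _ ⟨⟨i, -, rfl⟩, h⟩
      rw [show ⌊(B : ℝ) ^ k * x.1⌋₊ = i from h]
  part_zero := by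
    have : adicCell B 0 0 = Set.univ := by
      ext x
      simp [adicCell, x.2.2]
    ext I
    simp [adicPart, this]
  refines := by
    rintro k _ ⟨j, hj, rfl⟩
    have hj' : j < B ^ k * B := by rw [← pow_succ]; exact hj
    exact ⟨_, ⟨j / B, Nat.div_lt_of_lt_mul (by rwa [mul_comm]), rfl⟩,
      (adicCell_subset_iff hB hj).2 rfl⟩
  μ := adicMeasure hB
  measure_univ := by
    have : adicCell B 0 0 = Set.univ := by
      ext x
      simp [adicCell, x.2.2]
    rw [← this, adicMeasure_adicCell hB (by simp)]
    simp
  split := by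
    rintro k _ ⟨i, hi, rfl⟩
    -- The children of cell `i` are the cells `B * i + t` with `t < B`.
    have hlt (t : Fin B) : B * i + t < B ^ (k + 1) := by
      have : B * (i + 1) ≤ B * B ^ k := Nat.mul_le_mul_left _ hi
      rw [pow_succ']
      have := t.2
      lia
    have hdiv (t : Fin B) : (B * i + t) / B = i := by
      rw [Nat.mul_add_div (by lia), Nat.div_eq_of_lt t.2, add_zero]
    refine ⟨_, rfl, fun t : Fin B => adicCell B (k + 1) (B * i + t), ?_, ?_, ?_⟩
    · intro s t hst
      obtain ⟨x, hx⟩ := adicCell_nonempty hB (hlt s)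
      have h1 : ⌊(B : ℝ) ^ (k + 1) * x.1⌋₊ = B * i + s := hx
      have h2 : ⌊(B : ℝ) ^ (k + 1) * x.1⌋₊ = B * i + t := by
        have : x ∈ adicCell B (k + 1) (B * i + t) := by
          have hst : adicCell B (k + 1) (B * i + s) = adicCell B (k + 1) (B * i + t) := hst
          rwa [← hst]
        exact this
      exact Fin.ext (by lia)
    · ext J
      constructor
      · rintro ⟨t, rfl⟩
        exact ⟨⟨_, hlt t, rfl⟩, (adicCell_subset_iff hB (hlt t)).2 (hdiv t)⟩
      · rintro ⟨⟨j, hj, rfl⟩, hsub⟩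
        rw [adicCell_subset_iff hB hj] at hsub
        refine ⟨⟨j % B, Nat.mod_lt _ (by lia)⟩, ?_⟩
        simp only [← hsub, Nat.div_add_mod]
    · intro t
      change _ = ENNReal.ofReal (1 / (B : ℝ)) * _
      rw [adicMeasure_adicCell hB (hlt t), adicMeasure_adicCell hB hi,
        ← ENNReal.ofReal_mul (by positivity), pow_succ, mul_inv, one_div, mul_comm]

/-- A sequence of powers of `1 / B` in decreasing order with sum one is realized by
consecutive `B`-adic intervals. -/
theorem extremalE_le_tsum {B : ℕ} (hB : 2 ≤ B) {n : ℕ} {x : Fin (n + 1) → ℝ} {r : ℕ → ℕ}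
    (hr : Monotone r) {α : ℕ → ℝ} (hα : ∀ j, α j = 0 ∨ α j = ((B : ℝ) ^ r j)⁻¹)
    (hsum : ∑' j, ENNReal.ofReal (α j) = 1) (hx : Divides x fun j => ENNReal.ofReal (α j)) :
    extremalE {barycenterPoint B hB} n x ≤ ∑' j, (r j : ℝ≥0∞) * ENNReal.ofReal (α j) := by
  have hα0 (j : ℕ) : 0 ≤ α j := by rcases hα j with h | h <;> rw [h]; positivity
  let s : ℕ → ℝ := fun j => ∑ i ∈ Finset.range j, α i
  have hs_succ (j : ℕ) : s (j + 1) = s j + α j := Finset.sum_range_succ _ _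
  have hs_mono : Monotone s := monotone_nat_of_le_succ fun j => by
    rw [hs_succ]; linarith [hα0 j]
  have hs0 (j : ℕ) : 0 ≤ s j := Finset.sum_nonneg fun _ _ => hα0 _
  have hs1 (j : ℕ) : s j ≤ 1 := by
    have h := ENNReal.sum_le_tsum (f := fun j => ENNReal.ofReal (α j)) (Finset.range j)
    rw [hsum, ← ENNReal.ofReal_sum_of_nonneg fun i _ => hα0 i, ENNReal.ofReal_le_one] at h
    exact h
  -- Monotonicity of `r` matters here: all earlier masses are multiples of `B ^ (-r j)`, so the
  -- `j`-th interval starts at a grid point of level `r j`.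
  have hs_nat (j : ℕ) : ∃ N : ℕ, (B : ℝ) ^ r j * s j = N := by
    have : (B : ℝ) ^ r j * s j ∈ (Nat.castRingHom ℝ).rangeS := by
      rw [Finset.mul_sum]
      refine Subsemiring.sum_mem _ fun i hi => ?_
      rcases hα i with h | h
      · simp [h]
      · refine ⟨B ^ (r j - r i), ?_⟩
        rw [h, ← div_eq_mul_inv, eq_div_iff (by positivity)]
        simp only [Nat.coe_castRingHom, Nat.cast_pow]
        rw [← pow_add, Nat.sub_add_cancel (hr (Finset.mem_range.1 hi).le)]
    obtain ⟨N, hN⟩ := this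
    exact ⟨N, hN.symm⟩
  let I : ℕ → Set (Set.Ico (0 : ℝ) 1) := fun j => Subtype.val ⁻¹' Set.Ico (s j) (s (j + 1))
  have hI (j : ℕ) : (α j = 0 ∧ I j = ∅) ∨ I j ∈ adicPart B (r j) := by
    rcases hα j with h | h
    · refine Or.inl ⟨h, ?_⟩
      simp [I, hs_succ, h]
    · right
      obtain ⟨N, hN⟩ := hs_nat j
      have hBk : (0 : ℝ) < (B : ℝ) ^ r j := by positivity
      have h1 : s j = (N : ℝ) / (B : ℝ) ^ r j := by rw [← hN]; field_simp
      have h2 : s (j + 1) = ((N : ℝ) + 1) / (B : ℝ) ^ r j := by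
        rw [hs_succ, h1, h]; field_simp
      refine ⟨N, ?_, ?_⟩
      · have := hs1 (j + 1)
        rw [h2, div_le_one hBk] at this
        change N + 1 ≤ B ^ r j
        exact_mod_cast this
      · rw [adicCell_eq_preimage hB, ← h1, ← h2]
  have hμ (j : ℕ) : (adicRankedMeasure hB).μ (I j) = ENNReal.ofReal (α j) := by
    rcases hI j with ⟨h, h'⟩ | h
    · rw [h, h', measure_empty, ENNReal.ofReal_zero]
    · have := adicMeasure_preimage_Ico hB (hs0 j) (hs1 (j + 1))
        (MeasurableSpace.measurableSet_generateFrom (Set.mem_iUnion.2 ⟨r j, h⟩))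
      rwa [hs_succ, add_sub_cancel_left, ← hs_succ] at this
  have hle : extremalE {barycenterPoint B hB} n x ≤
      ∑' j, ((adicRankedMeasure hB).rank (I j) : ℝ≥0∞) * (adicRankedMeasure hB).μ (I j) := by
    refine sInf_le ⟨_, adicRankedMeasure hB, I, fun j => ?_, ?_, ?_, ?_, rfl⟩
    · rcases hI j with ⟨-, h⟩ | h
      · exact Or.inl h
      · exact Or.inr ⟨_, h⟩
    · intro i j hij
      exact (hs_mono.pairwise_disjoint_on_Ico_succ hij).preimage _
    · simp_rw [hμ, hsum]
    · simpa only [hμ] using hx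
  refine hle.trans (ENNReal.tsum_le_tsum fun j => ?_)
  rw [hμ]
  rcases hI j with ⟨h, -⟩ | h
  · simp [h]
  · gcongr
    exact (adicRankedMeasure hB).rank_le h

/-! ### Upper bound for `E_S` from base `B` digits. -/

/-- The base `B` digits of `y`, that of index zero being the integer part. -/
noncomputable def baseDigit (B : ℕ) (y : ℝ) : ℕ → ℕ
  | 0 => ⌊y⌋₊
  | i + 1 => ⌊(B : ℝ) ^ (i + 1) * y⌋₊ % B

theorem baseDigit_le {B : ℕ} (hB : 2 ≤ B) {y : ℝ} (hy : y ≤ 1) (i : ℕ) :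
    baseDigit B y i ≤ B := by
  cases i with
  | zero => exact (Nat.floor_le_of_le (by simpa using hy)).trans (by lia : 1 ≤ B)
  | succ i => exact (Nat.mod_lt _ (by lia)).le

theorem baseDigit_succ_div {B : ℕ} (hB : 2 ≤ B) (y : ℝ) (m : ℕ) :
    (baseDigit B y (m + 1) : ℝ) / (B : ℝ) ^ (m + 1) =
      (⌊(B : ℝ) ^ (m + 1) * y⌋₊ : ℝ) / (B : ℝ) ^ (m + 1) -
        (⌊(B : ℝ) ^ m * y⌋₊ : ℝ) / (B : ℝ) ^ m := by
  have hB0 : (B : ℝ) ≠ 0 := by positivity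
  have h := Nat.div_add_mod ⌊(B : ℝ) ^ (m + 1) * y⌋₊ B
  rw [floor_pow_succ_mul_div hB] at h
  have h' : (⌊(B : ℝ) ^ (m + 1) * y⌋₊ : ℝ) =
      B * (⌊(B : ℝ) ^ m * y⌋₊ : ℝ) + (baseDigit B y (m + 1) : ℝ) := by
    rw [← Nat.cast_mul, ← Nat.cast_add]
    exact congrArg Nat.cast h.symm
  rw [h', pow_succ]
  field_simp
  ring

theorem sum_range_baseDigit {B : ℕ} (hB : 2 ≤ B) (y : ℝ) (m : ℕ) :
    ∑ i ∈ Finset.range (m + 1), (baseDigit B y i : ℝ) / (B : ℝ) ^ i =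
      (⌊(B : ℝ) ^ m * y⌋₊ : ℝ) / (B : ℝ) ^ m := by
  induction m with
  | zero => simp [baseDigit]
  | succ m ih => rw [Finset.sum_range_succ, ih, baseDigit_succ_div hB]; ring

/-- Summation by parts: digit `i` is counted once for each `l < i`, and the digits in positions `l +
1` to `m` add up to a difference of truncations. -/
theorem sum_range_mul_baseDigit {B : ℕ} (hB : 2 ≤ B) (y : ℝ) (m : ℕ) :
    ∑ i ∈ Finset.range (m + 1), (i : ℝ) * ((baseDigit B y i : ℝ) / (B : ℝ) ^ i) =
      ∑ l ∈ Finset.range m, ((⌊(B : ℝ) ^ m * y⌋₊ : ℝ) / (B : ℝ) ^ m -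
        (⌊(B : ℝ) ^ l * y⌋₊ : ℝ) / (B : ℝ) ^ l) := by
  induction m with
  | zero => simp
  | succ m ih =>
    rw [Finset.sum_range_succ, ih, baseDigit_succ_div hB, Finset.sum_range_succ]
    simp only [Finset.sum_sub_distrib, Finset.sum_const, Finset.card_range, nsmul_eq_mul]
    push_cast
    ring

theorem sub_floor_div_pow {B : ℕ} (hB : 2 ≤ B) {y : ℝ} (hy : 0 ≤ y) (l : ℕ) :
    y - (⌊(B : ℝ) ^ l * y⌋₊ : ℝ) / (B : ℝ) ^ l =
      Int.fract ((B : ℝ) ^ l * y) / (B : ℝ) ^ l := by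
  have hB0 : (B : ℝ) ^ l ≠ 0 := by positivity
  rw [natCast_floor_eq_intCast_floor (by positivity), ← Int.self_sub_floor]
  field_simp

theorem hasSum_baseDigit {B : ℕ} (hB : 2 ≤ B) {y : ℝ} (hy : 0 ≤ y) :
    HasSum (fun i => (baseDigit B y i : ℝ) / (B : ℝ) ^ i) y := by
  rw [hasSum_iff_tendsto_nat_of_nonneg fun i => by positivity,
    ← Filter.tendsto_add_atTop_iff_nat 1]
  simp_rw [sum_range_baseDigit hB]
  have h := (summable_fract_div_pow hB y).tendsto_atTop_zero.const_sub y
  simp_rw [← sub_floor_div_pow hB hy] at h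
  simpa using h

theorem tsum_ofReal_baseDigit {B : ℕ} (hB : 2 ≤ B) {y : ℝ} (hy : 0 ≤ y) :
    ∑' i, ENNReal.ofReal ((baseDigit B y i : ℝ) / (B : ℝ) ^ i) = ENNReal.ofReal y := by
  have h := hasSum_baseDigit hB hy
  rw [← ENNReal.ofReal_tsum_of_nonneg (fun i => by positivity) h.summable, h.tsum_eq]

theorem tsum_mul_ofReal_baseDigit_le {B : ℕ} (hB : 2 ≤ B) {y : ℝ} (hy : 0 ≤ y) :
    ∑' i : ℕ, (i : ℝ≥0∞) * ENNReal.ofReal ((baseDigit B y i : ℝ) / (B : ℝ) ^ i) ≤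
      ENNReal.ofReal (fractSeries B y) := by
  have hterm (i : ℕ) : (i : ℝ≥0∞) * ENNReal.ofReal ((baseDigit B y i : ℝ) / (B : ℝ) ^ i) =
      ENNReal.ofReal ((i : ℝ) * ((baseDigit B y i : ℝ) / (B : ℝ) ^ i)) := by
    rw [ENNReal.ofReal_mul (by positivity), ENNReal.ofReal_natCast]
  simp_rw [hterm]
  refine ENNReal.tsum_le_of_sum_range_le fun m => ?_
  refine (Finset.sum_le_sum_of_subset (Finset.range_mono m.le_succ)).trans ?_
  rw [← ENNReal.ofReal_sum_of_nonneg fun i _ => by positivity]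
  refine ENNReal.ofReal_le_ofReal ?_
  rw [sum_range_mul_baseDigit hB]
  -- Replacing the level `m` truncation by `y` only increases each difference, and turns it into a
  -- term of `H_B`.
  calc _ ≤ ∑ l ∈ Finset.range m, Int.fract ((B : ℝ) ^ l * y) / (B : ℝ) ^ l := by
        refine Finset.sum_le_sum fun l _ => ?_
        rw [← sub_floor_div_pow hB hy]
        refine sub_le_sub_right ?_ _
        rw [← sub_nonneg, sub_floor_div_pow hB hy]
        exact div_nonneg (Int.fract_nonneg _) (by positivity)
    _ ≤ _ := (summable_fract_div_pow hB y).sum_le_tsum _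
        fun k _ => div_nonneg (Int.fract_nonneg _) (by positivity)

theorem sum_fin_ofReal_ite_lt {B D : ℕ} (hD : D ≤ B) {a : ℝ} :
    ∑ d : Fin B, ENNReal.ofReal (if (d : ℕ) < D then a else 0) = ENNReal.ofReal (D * a) := by
  rw [Fin.sum_univ_eq_sum_range (fun d => ENNReal.ofReal (if d < D then a else 0)),
    ← Finset.sum_subset (Finset.range_mono hD) fun d _ hd => by
      rw [if_neg (by simpa using hd), ENNReal.ofReal_zero],
    Finset.sum_congr rfl fun d hd => by rw [if_pos (Finset.mem_range.1 hd)]]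
  rw [ENNReal.ofReal_mul (by positivity), ENNReal.ofReal_natCast]
  simp

theorem extremalE_le_ofReal_sum_fractSeries {B : ℕ} (hB : 2 ≤ B) {n : ℕ}
    {x : Fin (n + 1) → ℝ} (hx : x ∈ stdSimplex ℝ (Fin (n + 1))) :
    extremalE {barycenterPoint B hB} n x ≤ ENNReal.ofReal (∑ k, fractSeries B (x k)) := by
  have hx1 (k) : x k ≤ 1 := by
    rw [← hx.2]
    exact Finset.single_le_sum (fun i _ => hx.1 i) (Finset.mem_univ k)
  have : NeZero ((n + 1) * B) := ⟨by positivity⟩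
  -- Division with remainder by `(n + 1) * B` lists the triples (level, coordinate, slot) level by
  -- level, so the ranks are nondecreasing.
  let e : ℕ ≃ ℕ × Fin (n + 1) × Fin B :=
    (Nat.divModEquiv ((n + 1) * B)).trans ((Equiv.refl ℕ).prodCongr finProdFinEquiv.symm)
  -- Each level and coordinate has `B` slots, of which as many as the digit are filled; the others
  -- have mass zero.
  let β : ℕ × Fin (n + 1) × Fin B → ℝ := fun p =>
    if (p.2.2 : ℕ) < baseDigit B (x p.2.1) p.1 then ((B : ℝ) ^ p.1)⁻¹ else 0
  have hβ (i : ℕ) (k : Fin (n + 1)) : ∑ d : Fin B, ENNReal.ofReal (β (i, k, d)) =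
      ENNReal.ofReal ((baseDigit B (x k) i : ℝ) / (B : ℝ) ^ i) := by
    rw [div_eq_mul_inv]
    exact sum_fin_ofReal_ite_lt (a := ((B : ℝ) ^ i)⁻¹) (baseDigit_le hB (hx1 k) i)
  have hdiv : Divides x fun j => ENNReal.ofReal (β (e j)) := by
    refine ⟨fun j => (e j).2.1, fun k => ?_⟩
    refine (tsum_subtype {j | (e j).2.1 = k} fun j => ENNReal.ofReal (β (e j))).trans ?_
    refine (e.tsum_eq fun p => {p : ℕ × Fin (n + 1) × Fin B | p.2.1 = k}.indicator
      (fun p => ENNReal.ofReal (β p)) p).trans ?_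
    rw [ENNReal.tsum_prod', ← tsum_ofReal_baseDigit hB (hx.1 k)]
    refine tsum_congr fun i => ?_
    rw [tsum_fintype, Fintype.sum_prod_type, Finset.sum_eq_single k]
    · simpa [Set.indicator] using hβ i k
    · intro k' _ hk'
      simp [Set.indicator, hk']
    · simp
  have hone : ∑' j, ENNReal.ofReal (β (e j)) = 1 := by
    rw [e.tsum_eq fun p => ENNReal.ofReal (β p), ENNReal.tsum_prod']
    simp_rw [tsum_fintype, Fintype.sum_prod_type, hβ]
    rw [Summable.tsum_finsetSum fun _ _ => ENNReal.summable]
    simp_rw [tsum_ofReal_baseDigit hB (hx.1 _)]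
    rw [← ENNReal.ofReal_sum_of_nonneg fun k _ => hx.1 k, hx.2, ENNReal.ofReal_one]
  have hmono : Monotone fun j => (e j).1 := fun i j hij => Nat.div_le_div_right hij
  refine (extremalE_le_tsum hB hmono (fun j => ?_) hone hdiv).trans ?_
  · simp only [β]
    split_ifs <;> simp
  · rw [e.tsum_eq fun p => (p.1 : ℝ≥0∞) * ENNReal.ofReal (β p), ENNReal.tsum_prod']
    simp_rw [tsum_fintype, Fintype.sum_prod_type, ← Finset.mul_sum, hβ, Finset.mul_sum]
    rw [Summable.tsum_finsetSum fun _ _ => ENNReal.summable,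
      ENNReal.ofReal_sum_of_nonneg fun k _ => fractSeries_nonneg _ _]
    exact Finset.sum_le_sum fun k _ => tsum_mul_ofReal_baseDigit_le hB (hx.1 k)

theorem extremalE_barycenterPoint {B : ℕ} (hB : 2 ≤ B) {n : ℕ}
    {x : Fin (n + 1) → ℝ} (hx : x ∈ stdSimplex ℝ (Fin (n + 1))) :
    extremalE {barycenterPoint B hB} n x = ENNReal.ofReal (∑ k, fractSeries B (x k)) :=
  (extremalE_le_ofReal_sum_fractSeries hB hx).antisymm
    (ofReal_sum_fractSeries_le_extremalE hB hx.1)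

/-! ### The supremum `κ`. -/

/-- The terms up to `l = Nat.log B n` equal 1; the later ones form a geometric series of ratio `1 /
B`. -/
theorem hasSum_min_div_pow {B : ℕ} (hB : 2 ≤ B) {n : ℕ} (hn : 1 ≤ n) :
    HasSum (fun l : ℕ => ((min n (B ^ l) : ℕ) : ℝ) / (B : ℝ) ^ l)
      ((Nat.log B n : ℝ) + 1 + (n : ℝ) / (((B : ℝ) - 1) * (B : ℝ) ^ Nat.log B n)) := by
  have hB' : (1 : ℝ) < B := by exact_mod_cast hB
  have hB1 : (B : ℝ) - 1 ≠ 0 := by linarith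
  set L := Nat.log B n
  have hlow : ∑ l ∈ Finset.range (L + 1), ((min n (B ^ l) : ℕ) : ℝ) / (B : ℝ) ^ l = L + 1 := by
    rw [Finset.sum_congr rfl (g := fun _ => (1 : ℝ))]
    · simp
    · intro l hl
      have : B ^ l ≤ n :=
        Nat.pow_le_of_le_log (by lia) (Nat.lt_succ_iff.1 (Finset.mem_range.1 hl))
      rw [min_eq_right this, Nat.cast_pow, div_self (by positivity)]
  rw [← hlow, add_comm, ← hasSum_nat_add_iff]
  have hgeom := (hasSum_geometric_of_lt_one (r := (B : ℝ)⁻¹) (by positivity)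
    (inv_lt_one_of_one_lt₀ hB')).mul_left ((n : ℝ) / (B : ℝ) ^ (L + 1))
  have hval : (n : ℝ) / (B : ℝ) ^ (L + 1) * (1 - (B : ℝ)⁻¹)⁻¹ =
      (n : ℝ) / (((B : ℝ) - 1) * (B : ℝ) ^ L) := by
    have : 1 - (B : ℝ)⁻¹ = ((B : ℝ) - 1) / B := by field_simp
    rw [this, inv_div, pow_succ]
    field_simp
  rw [hval] at hgeom
  refine hgeom.congr_fun fun l => ?_
  have : n ≤ B ^ (l + (L + 1)) :=
    (Nat.lt_pow_succ_log_self (by lia) n).le.trans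
      (Nat.pow_le_pow_right (by lia) (Nat.le_add_left _ _))
  rw [min_eq_left this, inv_pow, pow_add]
  field_simp

theorem hasSum_sum_fract_div_pow {B : ℕ} (hB : 2 ≤ B) {ι : Type*} [Fintype ι] (x : ι → ℝ) :
    HasSum (fun l : ℕ => (∑ k, Int.fract ((B : ℝ) ^ l * x k)) / (B : ℝ) ^ l)
      (∑ k, fractSeries B (x k)) := by
  simp_rw [Finset.sum_div]
  exact hasSum_sum fun k _ => (summable_fract_div_pow hB (x k)).hasSum

theorem sum_fract_le_min (B : ℕ) {n : ℕ} {x : Fin (n + 1) → ℝ}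
    (hx : x ∈ stdSimplex ℝ (Fin (n + 1))) (l : ℕ) :
    ∑ k, Int.fract ((B : ℝ) ^ l * x k) ≤ ((min n (B ^ l) : ℕ) : ℝ) := by
  have hsum : ∑ k, (B : ℝ) ^ l * x k = (B : ℝ) ^ l := by rw [← Finset.mul_sum, hx.2, mul_one]
  rw [Nat.cast_min]
  refine le_min ?_ ?_
  · have hint : ∑ k, Int.fract ((B : ℝ) ^ l * x k) =
        ((B ^ l - ∑ k, ⌊(B : ℝ) ^ l * x k⌋ : ℤ) : ℝ) := by
      simp_rw [← Int.self_sub_floor]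
      rw [Finset.sum_sub_distrib, hsum]
      push_cast
      rfl
    have hlt : ∑ k, Int.fract ((B : ℝ) ^ l * x k) < ∑ _k : Fin (n + 1), (1 : ℝ) :=
      Finset.sum_lt_sum_of_nonempty Finset.univ_nonempty fun k _ => Int.fract_lt_one _
    rw [hint] at hlt ⊢
    simp only [Finset.sum_const, Finset.card_univ, Fintype.card_fin, nsmul_eq_mul, mul_one] at hlt
    have : (B ^ l - ∑ k, ⌊(B : ℝ) ^ l * x k⌋ : ℤ) < ((n + 1 : ℕ) : ℤ) := by exact_mod_cast hlt
    have : (B ^ l - ∑ k, ⌊(B : ℝ) ^ l * x k⌋ : ℤ) ≤ n := by lia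
    exact_mod_cast this
  · have hBl : (0 : ℝ) ≤ (B : ℝ) ^ l := by positivity
    rw [Nat.cast_pow]
    refine le_of_le_of_eq ?_ hsum
    exact Finset.sum_le_sum fun k _ => fract_le_self (mul_nonneg hBl (hx.1 k))

/-- The point `(B - 1) / (B ^ (n + 1) - 1) * (1, B, …, B ^ n)`: multiplication by `B` modulo one
permutes its coordinates cyclically. -/
noncomputable def cyclicPoint (B n : ℕ) (k : Fin (n + 1)) : ℝ :=
  ((B : ℝ) - 1) * (B : ℝ) ^ (k : ℕ) / ((B : ℝ) ^ (n + 1) - 1)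

theorem sum_cyclicPoint {B : ℕ} (hB : 2 ≤ B) (n : ℕ) : ∑ k, cyclicPoint B n k = 1 := by
  have hB' : (1 : ℝ) < B := by exact_mod_cast hB
  have hQ : (B : ℝ) ^ (n + 1) - 1 ≠ 0 := (sub_pos.2 (one_lt_pow₀ hB' (by simp))).ne'
  simp only [cyclicPoint]
  rw [← Finset.sum_div, ← Finset.mul_sum, Fin.sum_univ_eq_sum_range (fun k => (B : ℝ) ^ k),
    mul_geom_sum, div_self hQ]

theorem cyclicPoint_pos {B : ℕ} (hB : 2 ≤ B) {n : ℕ} (k : Fin (n + 1)) :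
    0 < cyclicPoint B n k := by
  have hB' : (1 : ℝ) < B := by exact_mod_cast hB
  have hQ : 0 < (B : ℝ) ^ (n + 1) - 1 := sub_pos.2 (one_lt_pow₀ hB' (by simp))
  exact div_pos (mul_pos (sub_pos.2 hB') (by positivity)) hQ

theorem cyclicPoint_lt_one {B : ℕ} (hB : 2 ≤ B) {n : ℕ} (hn : 1 ≤ n) (k : Fin (n + 1)) :
    cyclicPoint B n k < 1 := by
  have hnt : Nontrivial (Fin (n + 1)) := Fin.nontrivial_iff_two_le.2 (by lia)
  obtain ⟨j, hj⟩ := exists_ne k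
  rw [← sum_cyclicPoint hB n]
  exact Finset.single_lt_sum hj (Finset.mem_univ k) (Finset.mem_univ j) (cyclicPoint_pos hB j)
    fun i _ _ => (cyclicPoint_pos hB i).le

theorem fract_mul_cyclicPoint {B : ℕ} (hB : 2 ≤ B) {n : ℕ} (hn : 1 ≤ n) (k : Fin (n + 1)) :
    Int.fract ((B : ℝ) * cyclicPoint B n k) = cyclicPoint B n (finRotate (n + 1) k) := by
  have hB' : (1 : ℝ) < B := by exact_mod_cast hB
  have hQ : (B : ℝ) ^ (n + 1) - 1 ≠ 0 := (sub_pos.2 (one_lt_pow₀ hB' (by simp))).ne'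
  refine Int.fract_eq_iff.2 ⟨(cyclicPoint_pos hB _).le, cyclicPoint_lt_one hB hn _, ?_⟩
  rw [finRotate_apply]
  induction k using Fin.lastCases with
  | last =>
    -- Only the last coordinate wraps around: `B ^ (n + 1)` is reduced to `1`, and the integer lost
    -- is `B - 1`.
    refine ⟨B - 1, ?_⟩
    simp only [cyclicPoint, Fin.last_add_one, Fin.val_last, Fin.val_zero]
    push_cast
    field_simp
    ring
  | cast i =>
    refine ⟨0, ?_⟩
    simp only [cyclicPoint, Fin.coeSucc_eq_succ, Fin.val_castSucc, Fin.val_succ]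
    push_cast
    field_simp
    ring

theorem exists_perm_fract_pow_mul_cyclicPoint {B : ℕ} (hB : 2 ≤ B) {n : ℕ} (hn : 1 ≤ n) (l : ℕ) :
    ∃ σ : Equiv.Perm (Fin (n + 1)), ∀ k,
      Int.fract ((B : ℝ) ^ l * cyclicPoint B n k) = cyclicPoint B n (σ k) := by
  induction l with
  | zero =>
    refine ⟨1, fun k => ?_⟩
    rw [pow_zero, one_mul, Int.fract_eq_self.2 ⟨(cyclicPoint_pos hB k).le,
      cyclicPoint_lt_one hB hn k⟩, Equiv.Perm.one_apply]
  | succ l ih =>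
    obtain ⟨σ, hσ⟩ := ih
    refine ⟨finRotate (n + 1) * σ, fun k => ?_⟩
    rw [Equiv.Perm.mul_apply, ← fract_mul_cyclicPoint hB hn, ← hσ, pow_succ', mul_assoc]
    have := fract_pow_mul_fract B 1 ((B : ℝ) ^ l * cyclicPoint B n k)
    rw [pow_one] at this
    exact this.symm

/-- The fractional parts of the cyclic point are nonzero, so those of its complement are one minus
them; `n + 1` ones minus total mass 1 leave `n`. -/
theorem sum_fract_pow_mul_one_sub_cyclicPoint {B : ℕ} (hB : 2 ≤ B) {n : ℕ} (hn : 1 ≤ n) (l : ℕ) :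
    ∑ k, Int.fract ((B : ℝ) ^ l * (1 - cyclicPoint B n k)) = n := by
  obtain ⟨σ, hσ⟩ := exists_perm_fract_pow_mul_cyclicPoint hB hn l
  have key (k : Fin (n + 1)) : Int.fract ((B : ℝ) ^ l * (1 - cyclicPoint B n k)) =
      1 - cyclicPoint B n (σ k) := by
    have : (B : ℝ) ^ l * (1 - cyclicPoint B n k) =
        ((B ^ l : ℕ) : ℝ) + -((B : ℝ) ^ l * cyclicPoint B n k) := by push_cast; ring
    rw [this, Int.fract_natCast_add, Int.fract_neg (by rw [hσ]; exact (cyclicPoint_pos hB _).ne'),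
      hσ]
  simp_rw [key]
  rw [Finset.sum_sub_distrib, Equiv.sum_comp σ, sum_cyclicPoint hB]
  simp

theorem exists_fin_sum_eq (b m : ℕ) : ∀ T ≤ m * b, ∃ c : Fin m → ℕ, (∀ k, c k ≤ b) ∧
    ∑ k, c k = T := by
  induction m with
  | zero =>
    intro T hT
    exact ⟨fun _ => 0, fun _ => Nat.zero_le _, by simp; lia⟩
  | succ m ih =>
    intro T hT
    rw [Nat.succ_mul] at hT
    obtain ⟨c, hc, hs⟩ := ih (T - min T b) (by lia)
    refine ⟨Fin.cons (min T b) c, fun k => ?_, ?_⟩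
    · refine Fin.cases ?_ (fun k => ?_) k
      · simp
      · simpa using hc k
    · rw [Fin.sum_cons, hs]
      lia

/-- Put one digit `c k` at position `L + 1`, followed by the tail `1 - cyclicPoint B n k`. Up to
level `L` nothing reaches 1, so the sum is `B ^ l`; beyond it the digit is dropped and the tail
always gives `n`. -/
theorem exists_sum_fract_eq_min {B : ℕ} (hB : 2 ≤ B) {n : ℕ} (hn : 1 ≤ n) :
    ∃ x ∈ stdSimplex ℝ (Fin (n + 1)), ∀ l : ℕ,
      ∑ k, Int.fract ((B : ℝ) ^ l * x k) = ((min n (B ^ l) : ℕ) : ℝ) := by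
  have hB' : (1 : ℝ) < B := by exact_mod_cast hB
  set L := Nat.log B n
  have hlow : B ^ L ≤ n := Nat.pow_log_le_self B (by lia)
  have hhigh : n < B ^ (L + 1) := Nat.lt_pow_succ_log_self (by lia) n
  -- The tails sum to `n`, so the digits must sum to `B ^ (L + 1) - n`. This fits in `n + 1` digits
  -- because `B ^ L ≤ n`.
  obtain ⟨c, hc, hcs⟩ := exists_fin_sum_eq (B - 1) (n + 1) (B ^ (L + 1) - n) (by
    obtain ⟨b, rfl⟩ : ∃ b, B = b + 1 := ⟨B - 1, by lia⟩
    rw [pow_succ, Nat.add_sub_cancel]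
    have := Nat.mul_le_mul_right (b + 1) hlow
    rw [tsub_le_iff_right]
    nlinarith)
  have hcs' : ∑ k, (c k : ℝ) = (B : ℝ) ^ (L + 1) - n := by
    rw [← Nat.cast_sum, hcs, Nat.cast_sub hhigh.le, Nat.cast_pow]
  have hc' (k) : (c k : ℝ) ≤ B - 1 := by
    have : c k + 1 ≤ B := by have := hc k; lia
    have : (c k : ℝ) + 1 ≤ B := by exact_mod_cast this
    linarith
  let x : Fin (n + 1) → ℝ := fun k => ((c k : ℝ) + (1 - cyclicPoint B n k)) / (B : ℝ) ^ (L + 1)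
  have hx : x ∈ stdSimplex ℝ (Fin (n + 1)) := by
    refine ⟨fun k => div_nonneg (add_nonneg (Nat.cast_nonneg _)
      (sub_nonneg.2 (cyclicPoint_lt_one hB hn k).le)) (by positivity), ?_⟩
    simp only [x]
    rw [← Finset.sum_div, Finset.sum_add_distrib, hcs', Finset.sum_sub_distrib, sum_cyclicPoint hB]
    simp only [Finset.sum_const, Finset.card_univ, Fintype.card_fin, nsmul_eq_mul, mul_one]
    push_cast
    rw [div_eq_one_iff_eq (by positivity)]
    ring
  refine ⟨x, hx, fun l => ?_⟩
  rcases le_or_gt l L with hl | hl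
  · have hle : B ^ l ≤ n := (Nat.pow_le_pow_right (by lia) hl).trans hlow
    rw [min_eq_right hle]
    have hlt (k) : (B : ℝ) ^ l * x k < 1 := by
      calc (B : ℝ) ^ l * x k ≤ (B : ℝ) ^ L * x k :=
            mul_le_mul_of_nonneg_right (pow_le_pow_right₀ hB'.le hl) (hx.1 k)
        _ = ((c k : ℝ) + (1 - cyclicPoint B n k)) / B := by
            simp only [x]
            rw [pow_succ]
            field_simp
        _ < 1 := by
            rw [div_lt_one (by positivity)]
            -- Strictness comes from positivity of the cyclic point, even when `c k = B - 1`.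
            linarith [hc' k, cyclicPoint_pos hB k]
    rw [Finset.sum_congr rfl fun k _ =>
      Int.fract_eq_self.2 ⟨mul_nonneg (by positivity) (hx.1 k), hlt k⟩,
      ← Finset.mul_sum, hx.2, mul_one, Nat.cast_pow]
  · obtain ⟨j, rfl⟩ : ∃ j, l = L + 1 + j := Nat.exists_eq_add_of_le hl
    rw [min_eq_left (hhigh.le.trans (Nat.pow_le_pow_right (by lia) (Nat.le_add_right _ _))),
      ← sum_fract_pow_mul_one_sub_cyclicPoint hB hn j]
    refine Finset.sum_congr rfl fun k _ => ?_
    have : (B : ℝ) ^ (L + 1 + j) * x k =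
        ((B ^ j * c k : ℕ) : ℝ) + (B : ℝ) ^ j * (1 - cyclicPoint B n k) := by
      simp only [x]
      rw [pow_add]
      push_cast
      field_simp
    rw [this, Int.fract_natCast_add]

theorem kappa_barycenterPoint {B : ℕ} (hB : 2 ≤ B) {n : ℕ} (hn : 1 ≤ n) :
    kappa {barycenterPoint B hB} n = ENNReal.ofReal
      ((Nat.log B n : ℝ) + 1 + (n : ℝ) / (((B : ℝ) - 1) * (B : ℝ) ^ Nat.log B n)) := by
  refine le_antisymm (iSup₂_le fun x hx => ?_) ?_
  · rw [extremalE_barycenterPoint hB hx]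
    refine ENNReal.ofReal_le_ofReal ?_
    refine hasSum_le (fun l => ?_) (hasSum_sum_fract_div_pow hB x) (hasSum_min_div_pow hB hn)
    gcongr
    exact sum_fract_le_min B hx l
  · obtain ⟨x, hx, h⟩ := exists_sum_fract_eq_min hB hn
    refine le_iSup₂_of_le x hx ?_
    rw [extremalE_barycenterPoint hB hx]
    have hs := hasSum_sum_fract_div_pow hB x
    simp_rw [h] at hs
    rw [hs.unique (hasSum_min_div_pow hB hn)]

theorem isExtremalAlmostConvex_extremalE {B : ℕ} (hB : 2 ≤ B) (n : ℕ) :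
    IsExtremalAlmostConvex {barycenterPoint B hB} n
      (fun x => (extremalE {barycenterPoint B hB} n x).toReal) := by
  have hE {x : Fin (n + 1) → ℝ} (hx : x ∈ stdSimplex ℝ (Fin (n + 1))) :
      (extremalE {barycenterPoint B hB} n x).toReal = ∑ k, fractSeries B (x k) := by
    rw [extremalE_barycenterPoint hB hx,
      ENNReal.toReal_ofReal (Finset.sum_nonneg fun _ _ => fractSeries_nonneg _ _)]
  refine ⟨?_, ?_, fun k => ?_, fun h hbdd hconv hv x hx => ?_⟩
  · obtain ⟨M, hM⟩ := boundedFunOn_sum_fractSeries hB (stdSimplex ℝ (Fin (n + 1)))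
    exact ⟨M, fun x hx => by simpa only [hE hx] using hM x hx⟩
  · rw [almostConvexOn_barycenterPoint]
    intro x hx
    have hB0 : (B : ℝ) ≠ 0 := by positivity
    rw [hE ((convex_stdSimplex ℝ _).sum_mem (fun _ _ => by positivity) (by simp [hB0])
      fun i _ => hx i)]
    simp_rw [hE (hx _)]
    exact sum_fractSeries_smul_sum_le hB x hx
  · rw [hE (single_mem_stdSimplex ℝ k)]
    refine Finset.sum_eq_zero fun i _ => ?_
    rcases eq_or_ne i k with rfl | hik
    · simpa using fractSeries_intCast B 1
    · simpa [hik] using fractSeries_intCast B 0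
  · rw [hE hx]
    exact le_sum_fractSeries hB hbdd hconv hv hx

theorem theorem3p1 (B : ℕ) (hB : 2 ≤ B) (n : ℕ) :
    (∀ x ∈ stdSimplex ℝ (Fin (n + 1)),
      extremalE {barycenterPoint B hB} n x = ENNReal.ofReal (∑ k, fractSeries B (x k))) ∧
    IsExtremalAlmostConvex {barycenterPoint B hB} n
      (fun x => (extremalE {barycenterPoint B hB} n x).toReal) ∧
    (1 ≤ n →
      kappa {barycenterPoint B hB} n =
        ENNReal.ofReal ((⌊Real.logb B n⌋ : ℝ) + 1 +
          (n : ℝ) / (((B : ℝ) - 1) * (B : ℝ) ^ ⌊Real.logb B n⌋))) := by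
  refine ⟨fun x hx => extremalE_barycenterPoint hB hx, isExtremalAlmostConvex_extremalE hB n,
    fun hn => ?_⟩
  rw [kappa_barycenterPoint hB hn, Real.floor_logb_natCast n.cast_nonneg, Int.log_natCast,
    zpow_natCast, Int.cast_natCast]
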